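/- Let $n\ge 2$ and let $\mathcal O_n$ be the Cuntz algebra, i.e. a non-zero unital $C^*$-algebra generated by isometries $S_1,\dots,S_n$ with $\sum_{i=1}^n S_iS_i^*=1$. For a finite word (multi-index) $\mu=\mu_1\cdots\mu_k$ over $\{1,\dots,n\}$ put $S_\mu=S_{\mu_1}\cdots S_{\mu_k}$ (with $S_\emptyset=1$) and $P_\mu=S_\mu S_\mu^*$. Let the core UHF-subalgebra $\mathcal F_n$ be the norm closure of $\bigcup_{k\ge 0}\operatorname{span}\{S_\mu S_\nu^* : |\mu|=|\nu|=k\}$. A unital $*$-endomorphism $\alpha$ of $\mathcal O_n$ is called modestly scaling if, for every sequence $(\nu_k)_{k\ge1}$ of non-empty words, every projection $p\in\mathcal O_n$ with $p\le\alpha(P_{\nu_1\cdots\nu_k})$ for all $k\geq 1$ is $0$ (here $\nu_1\cdots\nu_k$ denotes concatenation). Let $\alpha$ be a unital $*$-endomorphism of $\mathcal O_n$. Then $\alpha$ is modestly scaling if one of the following conditions holds: (i) $\alpha$ is an automorphism of $\mathcal O_n$; (ii) $\alpha(\mathcal F_n)\subseteq\mathcal F_n$. -/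

import Mathlib

namespace Cuntz

/-- The isometry `S_μ = S_{μ₁} ⋯ S_{μ_k}` attached to a multi-index `μ = μ₁ … μ_k`
(a finite word over `{1, …, n}`); the empty word gives `1`. -/
noncomputable def wordIsometry {n : ℕ} {A : Type*} [CStarAlgebra A] (S : Fin n → A) (μ : List (Fin n)) : A :=
  (μ.map S).prod

/-- The range projection `P_μ = S_μ S_μ^*`. -/
noncomputable def wordProjection {n : ℕ} {A : Type*} [CStarAlgebra A] (S : Fin n → A) (μ : List (Fin n)) : A :=
  wordIsometry S μ * star (wordIsometry S μ)

/-- `A` is the Cuntz algebra `O_n` with canonical generators `S_1, …, S_n`: it is a non-zero unital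
C*-algebra generated, as a C*-algebra, by isometries `S_1, …, S_n` with `∑ S_i S_i^* = 1`. -/
structure IsCuntzAlgebra {n : ℕ} {A : Type*} [CStarAlgebra A] (S : Fin n → A) : Prop where
  two_le : 2 ≤ n
  nontrivial : Nontrivial A
  isometry : ∀ i, star (S i) * S i = 1
  sum_range : ∑ i, S i * star (S i) = 1
  generates : (StarAlgebra.adjoin ℂ (Set.range S)).topologicalClosure = ⊤

/-- `F_n^k`: the linear span of all `S_μ S_ν^*` with `|μ| = |ν| = k`. -/
noncomputable def coreLevel {n : ℕ} {A : Type*} [CStarAlgebra A] (S : Fin n → A) (k : ℕ) : Submodule ℂ A :=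
  Submodule.span ℂ {x | ∃ μ ν : List (Fin n), μ.length = k ∧ ν.length = k ∧
    x = wordIsometry S μ * star (wordIsometry S ν)}

/-- The core UHF-subalgebra `F_n`: the norm closure of `⋃ₖ F_n^k`. -/
def coreUHF {n : ℕ} {A : Type*} [CStarAlgebra A] (S : Fin n → A) : Set A :=
  closure (⋃ k, (coreLevel S k : Set A))

/-- A unital `*`-endomorphism `α` is modestly scaling if, for every sequence of non-empty words
`ν 0, ν 1, …`, the only projection lying below `α (P_{ν 0 ⋯ ν k})` for all `k` is `0`. -/
def IsModestlyScaling {n : ℕ} {A : Type*} [CStarAlgebra A] [PartialOrder A]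
    (S : Fin n → A) (α : A →⋆ₐ[ℂ] A) : Prop :=
  ∀ ν : ℕ → List (Fin n), (∀ k, ν k ≠ []) →
    ∀ p : A, IsStarProjection p →
      (∀ k : ℕ, p ≤ α (wordProjection S ((List.range (k + 1)).map ν).flatten)) → p = 0

end Cuntz

open Filter Topology
open scoped ComplexOrder

namespace Cuntz

variable {n : ℕ} {A : Type*} [CStarAlgebra A] {S : Fin n → A}

/-! ### Words -/

/-! The argument compares projections under a faithful KMS state `φ`, with `φ (S_i x) = n⁻¹ φ (x
S_i)`. Such a state is tracial against elements of the core. If `α` preserves the core, the `α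
(P_μ)` with `|μ| = k` are therefore interchangeable under `φ`, and each has mass `n⁻ᵏ`
(`map_wordProjection`). A projection below `α (P_μ)` for arbitrarily long `μ` has `φ`-mass zero,
hence vanishes. An automorphism is undone by its inverse, which reduces that case to the identity.

The state is the scalar limit of the iterates of `x ↦ n⁻¹ ∑ S_i^* x S_i` (`exists_kmsState`).

Faithfulness (`eq_zero_of_gnsNorm_eq_zero`) is proved by hand, without simplicity of `O_n`. If `φ
(x^* x) = 0`, then `x` acts as zero in the GNS space, so a nearby self-adjoint polynomial `y` in the
generators acts with norm at most `ε`. Homogeneous components are bounded in norm by the GNS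
operator norm (`norm_component_le`), and `y ^ j` has only linearly many in `j`. Taking roots gives
`‖y‖ ≤ ε`. -/

@[simp]
lemma wordIsometry_nil : wordIsometry S [] = 1 := by
  simp [wordIsometry]

lemma wordIsometry_cons (i : Fin n) (μ : List (Fin n)) :
    wordIsometry S (i :: μ) = S i * wordIsometry S μ := by
  simp [wordIsometry]

lemma wordIsometry_append (μ ν : List (Fin n)) :
    wordIsometry S (μ ++ ν) = wordIsometry S μ * wordIsometry S ν := by
  simp [wordIsometry]

lemma wordIsometry_singleton (i : Fin n) : wordIsometry S [i] = S i := by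
  simp [wordIsometry]

namespace IsCuntzAlgebra

variable (hS : IsCuntzAlgebra S)
include hS

/-! ### Relations among the word isometries -/

lemma natCast_ne_zero : (n : ℂ) ≠ 0 := by
  have := hS.two_le
  exact_mod_cast (by omega : n ≠ 0)

/-- Compressing `∑ S_k S_k^* = 1` by `S_j` writes `1` as a sum of positive elements whose `j`-th
term is already `1`, so the other terms vanish. -/
lemma star_mul_of_ne {i j : Fin n} (hij : i ≠ j) : star (S i) * S j = 0 := by
  let := CStarAlgebra.spectralOrder A
  have := CStarAlgebra.spectralOrderedRing A
  have hsum : ∑ k ∈ Finset.univ.erase j, star (star (S k) * S j) * (star (S k) * S j) = 0 := by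
    have h : ∑ k, star (star (S k) * S j) * (star (S k) * S j) = 1 := by
      calc _ = star (S j) * (∑ k, S k * star (S k)) * S j := by
            simp [Finset.mul_sum, Finset.sum_mul, mul_assoc]
        _ = 1 := by rw [hS.sum_range, mul_one, hS.isometry]
    rw [← Finset.add_sum_erase _ _ (Finset.mem_univ j), hS.isometry, star_one, one_mul] at h
    exact add_eq_left.1 h
  rw [Finset.sum_eq_zero_iff_of_nonneg fun k _ => star_mul_self_nonneg _] at hsum
  exact (CStarRing.star_mul_self_eq_zero_iff _).1 (hsum i (by simp [hij]))

lemma star_mul_eq (i j : Fin n) : star (S i) * S j = if i = j then 1 else 0 := by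
  split_ifs with h
  · rw [h, hS.isometry]
  · exact hS.star_mul_of_ne h

lemma star_wordIsometry_mul_self (μ : List (Fin n)) :
    star (wordIsometry S μ) * wordIsometry S μ = 1 := by
  induction μ with
  | nil => simp
  | cons i μ ih =>
    rw [wordIsometry_cons, star_mul, mul_assoc, ← mul_assoc (star (S i)), hS.isometry, one_mul, ih]

omit hS in
lemma norm_le_one_of_isometry {a : A} (ha : star a * a = 1) : ‖a‖ ≤ 1 := by
  cases subsingleton_or_nontrivial A
  · simp [Subsingleton.elim a 0]
  have h := CStarRing.norm_star_mul_self (x := a)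
  rw [ha, CStarRing.norm_one] at h
  nlinarith [norm_nonneg a]

lemma norm_wordIsometry_le (μ : List (Fin n)) : ‖wordIsometry S μ‖ ≤ 1 :=
  norm_le_one_of_isometry (hS.star_wordIsometry_mul_self μ)

lemma star_wordIsometry_mul_cases (μ ν : List (Fin n)) :
    star (wordIsometry S μ) * wordIsometry S ν = 0 ∨
      (∃ σ, ν = μ ++ σ ∧ star (wordIsometry S μ) * wordIsometry S ν = wordIsometry S σ) ∨
      ∃ σ, μ = ν ++ σ ∧ star (wordIsometry S μ) * wordIsometry S ν = star (wordIsometry S σ) := by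
  induction μ generalizing ν with
  | nil => exact .inr (.inl ⟨ν, by simp, by simp⟩)
  | cons i μ ih =>
    cases ν with
    | nil => exact .inr (.inr ⟨i :: μ, by simp, by simp⟩)
    | cons j ν =>
      have key : star (wordIsometry S (i :: μ)) * wordIsometry S (j :: ν) =
          star (wordIsometry S μ) * (if i = j then 1 else 0) * wordIsometry S ν := by
        rw [← hS.star_mul_eq, wordIsometry_cons, wordIsometry_cons, star_mul]
        simp only [mul_assoc]
      rw [key]
      split_ifs with h
      · subst h
        simpa using ih ν
      · simp

end IsCuntzAlgebra

/-! ### The grading by word length -/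

/-- The span of the monomials `S_μ S_ν^*` of degree `|μ| - |ν| = d`. -/
noncomputable def gradedPart (S : Fin n → A) (d : ℤ) : Submodule ℂ A :=
  Submodule.span ℂ {x | ∃ μ ν : List (Fin n), (μ.length : ℤ) - ν.length = d ∧
    x = wordIsometry S μ * star (wordIsometry S ν)}

/-- The elements whose homogeneous components have degrees of absolute value at most `m`. -/
noncomputable def degreeLE (S : Fin n → A) (m : ℕ) : Submodule ℂ A :=
  ⨆ d ∈ Finset.Icc (-m : ℤ) m, gradedPart S d

lemma monomial_mem_gradedPart {d : ℤ} {μ ν : List (Fin n)} (h : (μ.length : ℤ) - ν.length = d) :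
    wordIsometry S μ * star (wordIsometry S ν) ∈ gradedPart S d :=
  Submodule.subset_span ⟨μ, ν, h, rfl⟩

lemma star_mem_gradedPart {d : ℤ} {x : A} (hx : x ∈ gradedPart S d) :
    star x ∈ gradedPart S (-d) := by
  induction hx using Submodule.span_induction with
  | mem x hx =>
    obtain ⟨μ, ν, h, rfl⟩ := hx
    rw [star_mul, star_star]
    exact monomial_mem_gradedPart (by omega)
  | zero => simp
  | add x y _ _ hx hy => rw [star_add]; exact add_mem hx hy
  | smul c x _ hx => rw [star_smul]; exact Submodule.smul_mem _ _ hx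

lemma IsCuntzAlgebra.mul_mem_gradedPart (hS : IsCuntzAlgebra S) {d e : ℤ} {x y : A}
    (hx : x ∈ gradedPart S d) (hy : y ∈ gradedPart S e) : x * y ∈ gradedPart S (d + e) := by
  have hxy := Submodule.mul_mem_mul hx hy
  rw [gradedPart, gradedPart, Submodule.span_mul_span] at hxy
  refine Submodule.span_le.2 ?_ hxy
  rintro _ ⟨_, ⟨μ, ν, h, rfl⟩, _, ⟨ρ, σ, h', rfl⟩, rfl⟩
  have key : wordIsometry S μ * star (wordIsometry S ν) *
      (wordIsometry S ρ * star (wordIsometry S σ)) =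
      wordIsometry S μ * (star (wordIsometry S ν) * wordIsometry S ρ) *
        star (wordIsometry S σ) := by
    simp only [mul_assoc]
  simp only [SetLike.mem_coe]
  rw [key]
  rcases hS.star_wordIsometry_mul_cases ν ρ with h0 | ⟨τ, hτ, h0⟩ | ⟨τ, hτ, h0⟩ <;> rw [h0]
  · simp
  · rw [← wordIsometry_append]
    refine monomial_mem_gradedPart ?_
    simp only [hτ, List.length_append, Nat.cast_add] at h' ⊢
    omega
  · rw [mul_assoc, ← star_mul, ← wordIsometry_append]
    refine monomial_mem_gradedPart ?_
    simp only [hτ, List.length_append, Nat.cast_add] at h ⊢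
    omega

lemma mem_degreeLE_iff {m : ℕ} {x : A} : x ∈ degreeLE S m ↔
    ∃ f : ℤ → A, (∀ d, f d ∈ gradedPart S d) ∧ ∑ d ∈ Finset.Icc (-m : ℤ) m, f d = x := by
  rw [degreeLE, Submodule.mem_iSup_finset_iff_exists_sum]
  constructor
  · rintro ⟨f, hf⟩
    exact ⟨fun d => f d, fun d => (f d).2, hf⟩
  · rintro ⟨f, hf, h⟩
    exact ⟨fun d => ⟨f d, hf d⟩, h⟩

lemma gradedPart_le_degreeLE {m : ℕ} {d : ℤ} (hd : d ∈ Finset.Icc (-m : ℤ) m) :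
    gradedPart S d ≤ degreeLE S m :=
  le_iSup₂_of_le d hd le_rfl

lemma degreeLE_mono : Monotone (degreeLE S) := by
  intro m m' h
  refine iSup₂_le fun d hd => gradedPart_le_degreeLE ?_
  rw [Finset.mem_Icc] at hd ⊢
  omega

lemma star_mem_degreeLE {m : ℕ} {x : A} (hx : x ∈ degreeLE S m) : star x ∈ degreeLE S m := by
  obtain ⟨f, hf, rfl⟩ := mem_degreeLE_iff.1 hx
  rw [star_sum]
  refine sum_mem fun d hd => gradedPart_le_degreeLE ?_ (star_mem_gradedPart (hf d))
  rw [Finset.mem_Icc] at hd ⊢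
  omega

lemma one_mem_gradedPart : (1 : A) ∈ gradedPart S 0 := by
  simpa using monomial_mem_gradedPart (S := S) (d := 0) (μ := []) (ν := []) (by simp)

namespace IsCuntzAlgebra

variable (hS : IsCuntzAlgebra S)
include hS

lemma mul_mem_degreeLE {m m' : ℕ} {x y : A} (hx : x ∈ degreeLE S m) (hy : y ∈ degreeLE S m') :
    x * y ∈ degreeLE S (m + m') := by
  obtain ⟨f, hf, rfl⟩ := mem_degreeLE_iff.1 hx
  obtain ⟨g, hg, rfl⟩ := mem_degreeLE_iff.1 hy
  rw [Finset.sum_mul_sum]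
  refine sum_mem fun d hd => sum_mem fun e he =>
    gradedPart_le_degreeLE ?_ (hS.mul_mem_gradedPart (hf d) (hg e))
  rw [Finset.mem_Icc] at hd he ⊢
  omega

lemma pow_mem_degreeLE {m : ℕ} {x : A} (hx : x ∈ degreeLE S m) (j : ℕ) :
    x ^ j ∈ degreeLE S (j * m) := by
  induction j with
  | zero =>
    rw [pow_zero]
    exact gradedPart_le_degreeLE (by simp) one_mem_gradedPart
  | succ j ih =>
    rw [pow_succ, add_mul, one_mul]
    exact hS.mul_mem_degreeLE ih hx

lemma exists_mem_degreeLE {x : A} (hx : x ∈ StarAlgebra.adjoin ℂ (Set.range S)) :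
    ∃ m, x ∈ degreeLE S m := by
  induction hx using StarAlgebra.adjoin_induction with
  | mem x hx =>
    obtain ⟨i, rfl⟩ := hx
    refine ⟨1, gradedPart_le_degreeLE (d := 1) (by simp) ?_⟩
    simpa [wordIsometry_singleton] using
      monomial_mem_gradedPart (S := S) (d := 1) (μ := [i]) (ν := []) (by simp)
  | algebraMap c =>
    refine ⟨0, gradedPart_le_degreeLE (d := 0) (by simp) ?_⟩
    rw [Algebra.algebraMap_eq_smul_one]
    exact Submodule.smul_mem _ _ one_mem_gradedPart
  | add x y _ _ hx hy =>
    obtain ⟨m, hx⟩ := hx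
    obtain ⟨m', hy⟩ := hy
    exact ⟨max m m', add_mem (degreeLE_mono (le_max_left _ _) hx)
      (degreeLE_mono (le_max_right _ _) hy)⟩
  | mul x y _ _ hx hy =>
    obtain ⟨m, hx⟩ := hx
    obtain ⟨m', hy⟩ := hy
    exact ⟨_, hS.mul_mem_degreeLE hx hy⟩
  | star x _ hx =>
    obtain ⟨m, hx⟩ := hx
    exact ⟨m, star_mem_degreeLE hx⟩

lemma dense_adjoin : Dense (StarAlgebra.adjoin ℂ (Set.range S) : Set A) := by
  rw [dense_iff_closure_eq, ← StarSubalgebra.topologicalClosure_coe, hS.generates]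
  rfl

lemma exists_degreeLE_norm_sub_lt (x : A) {ε : ℝ} (hε : 0 < ε) :
    ∃ m, ∃ y ∈ degreeLE S m, ‖x - y‖ < ε := by
  obtain ⟨y, hy, h⟩ := Metric.dense_iff.1 hS.dense_adjoin x ε hε
  obtain ⟨m, hm⟩ := hS.exists_mem_degreeLE h
  exact ⟨m, y, hm, by rwa [Metric.mem_ball', dist_eq_norm] at hy⟩

end IsCuntzAlgebra

/-! ### The level subspaces of the core -/

lemma monomial_mem_coreLevel {μ ν : List (Fin n)} (h : μ.length = ν.length) :
    wordIsometry S μ * star (wordIsometry S ν) ∈ coreLevel S ν.length :=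
  Submodule.subset_span ⟨μ, ν, h, rfl, rfl⟩

lemma one_mem_coreLevel_zero : (1 : A) ∈ coreLevel S 0 := by
  simpa using monomial_mem_coreLevel (S := S) (μ := []) (ν := []) rfl

namespace IsCuntzAlgebra

variable (hS : IsCuntzAlgebra S)
include hS

lemma monomial_eq_sum (μ ν : List (Fin n)) : wordIsometry S μ * star (wordIsometry S ν) =
    ∑ i, wordIsometry S (μ ++ [i]) * star (wordIsometry S (ν ++ [i])) := by
  have (i : Fin n) : wordIsometry S (μ ++ [i]) * star (wordIsometry S (ν ++ [i])) =
      wordIsometry S μ * (S i * star (S i)) * star (wordIsometry S ν) := by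
    simp only [wordIsometry_append, wordIsometry_singleton, star_mul, mul_assoc]
  simp_rw [this]
  rw [← Finset.sum_mul, ← Finset.mul_sum, hS.sum_range, mul_one]

lemma coreLevel_mono : Monotone (coreLevel S) := by
  refine monotone_nat_of_le_succ fun k => Submodule.span_le.2 ?_
  rintro _ ⟨μ, ν, hμ, hν, rfl⟩
  rw [SetLike.mem_coe, hS.monomial_eq_sum]
  refine sum_mem fun i _ => Submodule.subset_span ⟨_, _, ?_, ?_, rfl⟩ <;> simp [hμ, hν]

lemma exists_mem_coreLevel {x : A} (hx : x ∈ gradedPart S 0) : ∃ k, x ∈ coreLevel S k := by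
  induction hx using Submodule.span_induction with
  | mem x hx =>
    obtain ⟨μ, ν, h, rfl⟩ := hx
    exact ⟨_, monomial_mem_coreLevel (by omega)⟩
  | zero => exact ⟨0, zero_mem _⟩
  | add x y _ _ hx hy =>
    obtain ⟨m, hx⟩ := hx
    obtain ⟨m', hy⟩ := hy
    exact ⟨max m m', add_mem (hS.coreLevel_mono (le_max_left _ _) hx)
      (hS.coreLevel_mono (le_max_right _ _) hy)⟩
  | smul c x _ hx =>
    obtain ⟨m, hx⟩ := hx
    exact ⟨m, Submodule.smul_mem _ _ hx⟩

lemma mul_mem_coreLevel {k : ℕ} {x y : A} (hx : x ∈ coreLevel S k) (hy : y ∈ coreLevel S k) :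
    x * y ∈ coreLevel S k := by
  have hxy := Submodule.mul_mem_mul hx hy
  rw [coreLevel, Submodule.span_mul_span] at hxy
  refine Submodule.span_le.2 ?_ hxy
  rintro _ ⟨_, ⟨μ, ν, h, hν, rfl⟩, _, ⟨ρ, σ, h', hσ, rfl⟩, rfl⟩
  have key : wordIsometry S μ * star (wordIsometry S ν) *
      (wordIsometry S ρ * star (wordIsometry S σ)) =
      wordIsometry S μ * (star (wordIsometry S ν) * wordIsometry S ρ) *
        star (wordIsometry S σ) := by
    simp only [mul_assoc]
  simp only [SetLike.mem_coe]
  rw [key]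
  have hmem : wordIsometry S μ * star (wordIsometry S σ) ∈ coreLevel S k :=
    Submodule.subset_span ⟨μ, σ, h, hσ, rfl⟩
  rcases hS.star_wordIsometry_mul_cases ν ρ with h0 | ⟨τ, hτ, h0⟩ | ⟨τ, hτ, h0⟩
  · simp [h0]
  all_goals
    have hτ0 : τ = [] := by
      have := congrArg List.length hτ
      rw [List.length_append] at this
      exact List.eq_nil_of_length_eq_zero (by omega)
    rw [h0, hτ0]
    simpa using hmem

lemma pow_mem_coreLevel {k : ℕ} {x : A} (hx : x ∈ coreLevel S k) (j : ℕ) :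
    x ^ j ∈ coreLevel S k := by
  induction j with
  | zero => exact pow_zero x ▸ hS.coreLevel_mono (Nat.zero_le k) one_mem_coreLevel_zero
  | succ j ih => exact pow_succ x j ▸ hS.mul_mem_coreLevel ih hx

omit hS in
lemma mem_coreLevel_zero {x : A} (hx : x ∈ coreLevel S 0) : ∃ c : ℂ, x = c • 1 := by
  have : coreLevel S 0 = Submodule.span ℂ {1} := by
    rw [coreLevel]
    congr 1
    ext x
    simp [List.length_eq_zero_iff]
  rw [this, Submodule.mem_span_singleton] at hx
  obtain ⟨c, rfl⟩ := hx
  exact ⟨c, rfl⟩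

lemma star_mul_mul_mem_coreLevel {k : ℕ} {x : A} (hx : x ∈ coreLevel S (k + 1)) (i j : Fin n) :
    star (S i) * x * S j ∈ coreLevel S k := by
  induction hx using Submodule.span_induction with
  | mem x hx =>
    obtain ⟨μ, ν, hμ, hν, rfl⟩ := hx
    obtain ⟨a, μ, rfl⟩ := List.exists_cons_of_length_eq_add_one hμ
    obtain ⟨b, ν, rfl⟩ := List.exists_cons_of_length_eq_add_one hν
    have : star (S i) * (wordIsometry S (a :: μ) * star (wordIsometry S (b :: ν))) * S j =
        (star (S i) * S a) * (wordIsometry S μ * star (wordIsometry S ν)) * (star (S b) * S j) := by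
      simp only [wordIsometry_cons, star_mul, mul_assoc]
    rw [this, hS.star_mul_eq, hS.star_mul_eq]
    split_ifs <;> simp
    exact Submodule.subset_span ⟨μ, ν, by simpa using hμ, by simpa using hν, rfl⟩
  | zero => simp
  | add x y _ _ hx hy => rw [mul_add, add_mul]; exact add_mem hx hy
  | smul c x _ hx =>
    rw [mul_smul_comm, smul_mul_assoc]
    exact Submodule.smul_mem _ _ hx

lemma eq_sum_compress (x : A) : x = ∑ i, ∑ j, S i * (star (S i) * x * S j) * star (S j) := by
  calc x = (∑ i, S i * star (S i)) * x * ∑ j, S j * star (S j) := by simp [hS.sum_range]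
    _ = _ := by
      simp only [Finset.sum_mul, Finset.mul_sum, mul_assoc]
      exact Finset.sum_comm

end IsCuntzAlgebra

/-! ### The transfer operator and the invariant state -/

/-- The unital completely positive map `x ↦ n⁻¹ ∑ S_i^* x S_i`. -/
noncomputable def transfer (S : Fin n → A) : A →ₗ[ℂ] A :=
  (n : ℂ)⁻¹ • ∑ i, LinearMap.mulRight ℂ (S i) ∘ₗ LinearMap.mulLeft ℂ (star (S i))

lemma transfer_apply (x : A) : transfer S x = (n : ℂ)⁻¹ • ∑ i, star (S i) * x * S i := by
  simp [transfer, LinearMap.sum_apply]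

namespace IsCuntzAlgebra

variable (hS : IsCuntzAlgebra S)
include hS

lemma transfer_one : transfer S 1 = 1 := by
  simp [transfer_apply, hS.isometry, ← Nat.cast_smul_eq_nsmul ℂ, smul_smul, hS.natCast_ne_zero]

lemma norm_star_mul_mul_le (i : Fin n) (x : A) : ‖star (S i) * x * S i‖ ≤ ‖x‖ := by
  have h := norm_le_one_of_isometry (hS.isometry i)
  calc ‖star (S i) * x * S i‖ ≤ ‖S i‖ * ‖x‖ * ‖S i‖ := by
        refine (norm_mul_le _ _).trans ?_
        gcongr
        exact (norm_mul_le _ _).trans_eq (by rw [norm_star])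
    _ ≤ 1 * ‖x‖ * 1 := by gcongr
    _ = ‖x‖ := by ring

lemma norm_transfer_le (x : A) : ‖transfer S x‖ ≤ ‖x‖ := by
  have hn : (0 : ℝ) < n := by exact_mod_cast (by have := hS.two_le; omega : 0 < n)
  rw [transfer_apply, norm_smul, norm_inv, Complex.norm_natCast, inv_mul_le_iff₀ hn]
  refine (norm_sum_le _ _).trans ?_
  refine (Finset.sum_le_sum fun i _ => hS.norm_star_mul_mul_le i x).trans_eq ?_
  simp

lemma norm_transfer_pow_le (k : ℕ) (x : A) : ‖(transfer S ^ k) x‖ ≤ ‖x‖ := by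
  induction k with
  | zero => simp
  | succ k ih =>
    rw [pow_succ', Module.End.mul_apply]
    exact (hS.norm_transfer_le _).trans ih

lemma transfer_mul_left (i : Fin n) (x : A) : transfer S (S i * x) = (n : ℂ)⁻¹ • (x * S i) := by
  rw [transfer_apply, Finset.sum_eq_single i]
  · rw [← mul_assoc, hS.isometry, one_mul]
  · intro j _ hj
    rw [← mul_assoc, hS.star_mul_of_ne hj, zero_mul, zero_mul]
  · simp

omit hS in
lemma star_transfer (x : A) : star (transfer S x) = transfer S (star x) := by
  simp [transfer_apply, mul_assoc, star_sum]

/-- Each application rotates the first letter to the end of the word and gains a factor `n⁻¹`. -/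
lemma norm_transfer_pow_wordIsometry_le (k : ℕ) (μ : List (Fin n)) (hμ : μ ≠ []) :
    ‖(transfer S ^ k) (wordIsometry S μ)‖ ≤ ((n : ℝ)⁻¹) ^ k := by
  induction k generalizing μ with
  | zero => simpa using hS.norm_wordIsometry_le μ
  | succ k ih =>
    obtain ⟨i, μ, rfl⟩ := List.exists_cons_of_ne_nil hμ
    rw [pow_succ, Module.End.mul_apply, wordIsometry_cons, hS.transfer_mul_left, map_smul,
      norm_smul, norm_inv, Complex.norm_natCast, ← wordIsometry_singleton (S := S) i,
      ← wordIsometry_append, pow_succ']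
    gcongr
    exact ih _ (by simp)

lemma tendsto_transfer_pow_wordIsometry (μ : List (Fin n)) :
    ∃ c : ℂ, Tendsto (fun k => (transfer S ^ k) (wordIsometry S μ)) atTop
      (𝓝 (algebraMap ℂ A c)) := by
  rcases eq_or_ne μ [] with rfl | hμ
  · refine ⟨1, tendsto_const_nhds.congr fun k => ?_⟩
    rw [wordIsometry_nil, map_one]
    induction k with
    | zero => simp
    | succ k ih => rw [pow_succ, Module.End.mul_apply, hS.transfer_one, ← ih]
  · refine ⟨0, ?_⟩
    rw [map_zero]
    refine squeeze_zero_norm (fun k => hS.norm_transfer_pow_wordIsometry_le k μ hμ) ?_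
    refine tendsto_pow_atTop_nhds_zero_of_lt_one (by positivity) ?_
    exact inv_lt_one_of_one_lt₀ (by exact_mod_cast hS.two_le)

omit hS in
/-- The elements whose iterates under `transfer S` converge to a scalar. -/
noncomputable def scalarLimitSubmodule (S : Fin n → A) : Submodule ℂ A where
  carrier := {x | ∃ c : ℂ, Tendsto (fun k => (transfer S ^ k) x) atTop (𝓝 (algebraMap ℂ A c))}
  zero_mem' := ⟨0, by simp⟩
  add_mem' := by
    rintro x y ⟨c, hc⟩ ⟨d, hd⟩
    exact ⟨c + d, by simpa using hc.add hd⟩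
  smul_mem' := by
    rintro a x ⟨c, hc⟩
    exact ⟨a * c, by
      simp_rw [map_smul]
      rw [map_mul, ← Algebra.smul_def]
      exact hc.const_smul a⟩

omit hS in
lemma mem_scalarLimitSubmodule_of_transfer {x : A}
    (hx : transfer S x ∈ scalarLimitSubmodule S) : x ∈ scalarLimitSubmodule S := by
  obtain ⟨c, hc⟩ := hx
  refine ⟨c, (tendsto_add_atTop_iff_nat 1).1 ?_⟩
  simpa only [pow_succ, Module.End.mul_apply] using hc

omit hS in
lemma star_mem_scalarLimitSubmodule {x : A} (hx : x ∈ scalarLimitSubmodule S) :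
    star x ∈ scalarLimitSubmodule S := by
  obtain ⟨c, hc⟩ := hx
  refine ⟨star c, ?_⟩
  have h (k : ℕ) : star ((transfer S ^ k) x) = (transfer S ^ k) (star x) := by
    induction k with
    | zero => simp
    | succ k ih => rw [pow_succ', Module.End.mul_apply, star_transfer, ih, Module.End.mul_apply]
  rw [algebraMap_star_comm]
  exact hc.star.congr h

/-- One application of `transfer` either kills the monomial or strips the first letter of both
words, up to a scalar. This ends with one word empty. -/
lemma monomial_mem_scalarLimitSubmodule (μ ν : List (Fin n)) :
    wordIsometry S μ * star (wordIsometry S ν) ∈ scalarLimitSubmodule S := by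
  induction μ generalizing ν with
  | nil =>
    rw [wordIsometry_nil, one_mul]
    exact star_mem_scalarLimitSubmodule (hS.tendsto_transfer_pow_wordIsometry ν)
  | cons i μ ih =>
    cases ν with
    | nil =>
      rw [wordIsometry_nil, star_one, mul_one]
      exact hS.tendsto_transfer_pow_wordIsometry (i :: μ)
    | cons j ν =>
      refine mem_scalarLimitSubmodule_of_transfer ?_
      rw [wordIsometry_cons, mul_assoc, hS.transfer_mul_left, wordIsometry_cons, star_mul,
        mul_assoc, mul_assoc, hS.star_mul_eq]
      refine Submodule.smul_mem _ _ ?_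
      split_ifs
      · simpa using ih ν
      · simp

omit hS in
lemma isClosed_range_algebraMap [Nontrivial A] : IsClosed (Set.range (algebraMap ℂ A)) :=
  (algebraMap_isometry ℂ A).isClosedEmbedding.isClosed_range

/-- All iterates of `transfer` are contractions, so approximation is uniform in `k`: limits persist,
and they stay in the closed set of scalars. -/
lemma isClosed_scalarLimitSubmodule : IsClosed (scalarLimitSubmodule S : Set A) := by
  have := hS.nontrivial
  refine isClosed_of_closure_subset fun x hx => ?_
  have approx (ε : ℝ) (hε : 0 < ε) : ∃ y ∈ scalarLimitSubmodule S,
      ∀ k, dist ((transfer S ^ k) x) ((transfer S ^ k) y) < ε := by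
    obtain ⟨y, hy, h⟩ := Metric.mem_closure_iff.1 hx ε hε
    refine ⟨y, hy, fun k => lt_of_le_of_lt ?_ h⟩
    rw [dist_eq_norm, dist_eq_norm, ← map_sub]
    exact hS.norm_transfer_pow_le k _
  have hcauchy : CauchySeq fun k => (transfer S ^ k) x := by
    rw [Metric.cauchySeq_iff']
    intro ε hε
    obtain ⟨y, ⟨c, hc⟩, h⟩ := approx (ε / 3) (by positivity)
    obtain ⟨N, hN⟩ := Metric.cauchySeq_iff'.1 hc.cauchySeq (ε / 3) (by positivity)
    refine ⟨N, fun k hk => ?_⟩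
    have h1 := h k
    have h2 := h N
    rw [dist_comm] at h2
    have h3 := dist_triangle4 ((transfer S ^ k) x) ((transfer S ^ k) y) ((transfer S ^ N) y)
      ((transfer S ^ N) x)
    linarith [hN k hk]
  obtain ⟨l, hl⟩ := cauchySeq_tendsto_of_complete hcauchy
  have hmem : l ∈ Set.range (algebraMap ℂ A) := by
    rw [← isClosed_range_algebraMap.closure_eq, Metric.mem_closure_iff]
    intro ε hε
    obtain ⟨y, ⟨c, hc⟩, h⟩ := approx (ε / 2) (by positivity)
    refine ⟨_, ⟨c, rfl⟩, ?_⟩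
    have := le_of_tendsto (hl.dist hc) (Eventually.of_forall fun k => (h k).le)
    linarith
  obtain ⟨c, rfl⟩ := hmem
  exact ⟨c, hl⟩

lemma exists_tendsto_transfer_pow (x : A) :
    ∃ c : ℂ, Tendsto (fun k => (transfer S ^ k) x) atTop (𝓝 (algebraMap ℂ A c)) := by
  refine hS.isClosed_scalarLimitSubmodule.closure_subset_iff.2 ?_ (hS.dense_adjoin x)
  intro y hy
  obtain ⟨m, hm⟩ := hS.exists_mem_degreeLE hy
  refine (iSup₂_le fun d _ => Submodule.span_le.2 ?_ :
    degreeLE S m ≤ scalarLimitSubmodule S) hm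
  rintro _ ⟨μ, ν, -, rfl⟩
  exact hS.monomial_mem_scalarLimitSubmodule μ ν

variable [PartialOrder A] [StarOrderedRing A]

/-- A Cuntz algebra has a state satisfying the KMS identity `φ (S_i x) = n⁻¹ φ (x S_i)`. -/
theorem exists_kmsState : ∃ φ : A →ₚ[ℂ] ℂ, φ 1 = 1 ∧
    ∀ i x, φ (S i * x) = (n : ℂ)⁻¹ * φ (x * S i) := by
  have := hS.nontrivial
  have hinj : Function.Injective (algebraMap ℂ A) := (algebraMap ℂ A).injective
  choose f hf using hS.exists_tendsto_transfer_pow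
  have huniq {x : A} {c : ℂ}
      (h : Tendsto (fun k => (transfer S ^ k) x) atTop (𝓝 (algebraMap ℂ A c))) : f x = c :=
    hinj (tendsto_nhds_unique (hf x) h)
  have htransfer (x : A) : f (transfer S x) = f x := by
    refine huniq ?_
    simpa only [pow_succ, Module.End.mul_apply] using (tendsto_add_atTop_iff_nat 1).2 (hf x)
  let g : A →ₗ[ℂ] ℂ :=
    { toFun := f
      map_add' := fun x y => huniq (by simpa using (hf x).add (hf y))
      map_smul' := fun a x => huniq (by
        simp_rw [map_smul]
        rw [RingHom.id_apply, smul_eq_mul, map_mul, ← Algebra.smul_def]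
        exact (hf x).const_smul a) }
  have hpow_nonneg (k : ℕ) (x : A) (hx : 0 ≤ x) : 0 ≤ (transfer S ^ k) x := by
    induction k with
    | zero => simpa
    | succ k ih =>
      rw [pow_succ', Module.End.mul_apply, transfer_apply]
      refine smul_nonneg (by simp) (Finset.sum_nonneg fun i _ => ?_)
      exact star_left_conjugate_nonneg ih (S i)
  have hpos (x : A) (hx : 0 ≤ x) : 0 ≤ g x := by
    have h : (0 : A) ≤ algebraMap ℂ A (f x) :=
      ge_of_tendsto (hf x) (Eventually.of_forall fun k => hpow_nonneg k x hx)
    exact spectrum_nonneg_of_nonneg h (by rw [spectrum.scalar_eq]; rfl)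
  refine ⟨PositiveLinearMap.mk₀ g hpos, huniq ?_, fun i x => ?_⟩
  · refine tendsto_const_nhds.congr fun k => ?_
    rw [map_one]
    induction k with
    | zero => simp
    | succ k ih => rw [pow_succ, Module.End.mul_apply, hS.transfer_one, ← ih]
  -- The KMS identity is invariance under `transfer` combined with `transfer_mul_left`.
  · change g (S i * x) = _ * g (x * S i)
    have h : g (S i * x) = g (transfer S (S i * x)) := (htransfer _).symm
    rw [h, hS.transfer_mul_left, map_smul, smul_eq_mul]

end IsCuntzAlgebra
variable [PartialOrder A] [StarOrderedRing A]

/-! ### The seminorm of a positive functional -/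

section GNSNorm

variable (φ : A →ₚ[ℂ] ℂ)

/-- The seminorm `x ↦ φ (x^* x) ^ (1/2)`. -/
noncomputable def gnsNorm (x : A) : ℝ := ‖φ.toPreGNS x‖

lemma gnsNorm_nonneg (x : A) : 0 ≤ gnsNorm φ x := norm_nonneg _

lemma gnsNorm_sq (x : A) : ((gnsNorm φ x : ℝ) : ℂ) ^ 2 = φ (star x * x) :=
  φ.preGNS_norm_sq (φ.toPreGNS x)

lemma gnsNorm_add_le (x y : A) : gnsNorm φ (x + y) ≤ gnsNorm φ x + gnsNorm φ y := by
  rw [gnsNorm, map_add]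
  exact norm_add_le _ _

lemma gnsNorm_smul (c : ℂ) (x : A) : gnsNorm φ (c • x) = ‖c‖ * gnsNorm φ x := by
  rw [gnsNorm, map_smul, norm_smul, gnsNorm]

lemma gnsNorm_zero : gnsNorm φ 0 = 0 := by
  rw [gnsNorm, map_zero, norm_zero]

lemma norm_map_star_mul_le (x y : A) : ‖φ (star x * y)‖ ≤ gnsNorm φ x * gnsNorm φ y :=
  norm_inner_le_norm (𝕜 := ℂ) (φ.toPreGNS x) (φ.toPreGNS y)

lemma gnsNorm_mul_le (x y : A) : gnsNorm φ (x * y) ≤ ‖x‖ * gnsNorm φ y :=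
  (φ.leftMulMapPreGNS x).le_of_opNorm_le
    (LinearMap.mkContinuous_norm_le _ (norm_nonneg x) _) (φ.toPreGNS y)

end GNSNorm

/-! ### KMS states -/

/-- A state on a Cuntz algebra with the KMS identity `φ (S_i x) = n⁻¹ φ (x S_i)`. -/
structure IsKMSState (S : Fin n → A) (φ : A →ₚ[ℂ] ℂ) : Prop where
  map_one : φ 1 = 1
  map_mul_left : ∀ i x, φ (S i * x) = (n : ℂ)⁻¹ * φ (x * S i)

namespace IsKMSState

variable {φ : A →ₚ[ℂ] ℂ} (hφ : IsKMSState S φ)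
include hφ

lemma map_mul_star (i : Fin n) (x : A) :
    φ (x * star (S i)) = (n : ℂ)⁻¹ * φ (star (S i) * x) := by
  have h := congrArg star (hφ.map_mul_left i (star x))
  rw [← map_star, star_mul, star_star, star_mul', ← map_star, star_mul, star_star] at h
  simpa using h

omit [StarOrderedRing A] in
lemma map_wordIsometry_mul (μ : List (Fin n)) (x : A) :
    φ (wordIsometry S μ * x) = ((n : ℂ)⁻¹) ^ μ.length * φ (x * wordIsometry S μ) := by
  induction μ generalizing x with
  | nil => simp
  | cons i μ ih =>
    rw [wordIsometry_cons, mul_assoc, hφ.map_mul_left, mul_assoc, ih, List.length_cons, pow_succ']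
    simp only [mul_assoc]

lemma map_mul_star_wordIsometry (μ : List (Fin n)) (x : A) :
    φ (x * star (wordIsometry S μ)) =
      ((n : ℂ)⁻¹) ^ μ.length * φ (star (wordIsometry S μ) * x) := by
  induction μ generalizing x with
  | nil => simp
  | cons i μ ih =>
    rw [wordIsometry_cons, star_mul, ← mul_assoc, hφ.map_mul_star, ← mul_assoc, ih,
      List.length_cons, pow_succ']
    simp only [mul_assoc]

/-- Moving `S_μ` or `S_ν^*` around gives `φ (S_μ S_ν^*)` as `n^(-|μ|)` and as `n^(-|ν|)` times the
same number. For different lengths that number must be zero. -/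
lemma map_eq_zero_of_mem_gradedPart (hS : IsCuntzAlgebra S) {d : ℤ} (hd : d ≠ 0) {x : A}
    (hx : x ∈ gradedPart S d) : φ x = 0 := by
  induction hx using Submodule.span_induction with
  | mem x hx =>
    obtain ⟨μ, ν, h, rfl⟩ := hx
    have h1 := hφ.map_wordIsometry_mul μ (star (wordIsometry S ν))
    have h2 := hφ.map_mul_star_wordIsometry ν (wordIsometry S μ)
    by_contra h0
    have hne : φ (star (wordIsometry S ν) * wordIsometry S μ) ≠ 0 := by
      rintro h3
      rw [h3, mul_zero] at h1
      exact h0 h1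
    have h4 : ((n : ℂ)⁻¹) ^ μ.length = ((n : ℂ)⁻¹) ^ ν.length :=
      mul_right_cancel₀ hne (h1.symm.trans h2)
    rw [inv_pow, inv_pow, inv_inj] at h4
    have h5 : μ.length = ν.length := Nat.pow_right_injective hS.two_le (by exact_mod_cast h4)
    omega
  | zero => simp
  | add x y _ _ hx hy => rw [map_add, hx, hy, add_zero]
  | smul c x _ hx => rw [map_smul, hx, smul_zero]

/-- The core lies in the centralizer of a KMS state. -/
lemma map_mul_comm_of_mem_coreUHF {u : A} (hu : u ∈ coreUHF S) (x : A) :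
    φ (u * x) = φ (x * u) := by
  have hcont : Continuous φ := map_continuous φ
  have hclosed : IsClosed {u : A | φ (u * x) = φ (x * u)} :=
    isClosed_eq (by fun_prop) (by fun_prop)
  refine hclosed.closure_subset_iff.2 ?_ hu
  refine Set.iUnion_subset fun k u hu => ?_
  simp only [Set.mem_ofPred_eq]
  induction hu using Submodule.span_induction with
  | mem u hu =>
    obtain ⟨μ, ν, hμ, hν, rfl⟩ := hu
    rw [mul_assoc, hφ.map_wordIsometry_mul, ← mul_assoc x, hφ.map_mul_star_wordIsometry, hμ, hν,
      mul_assoc]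
  | zero => simp
  | add u v _ _ hu hv => rw [add_mul, mul_add, map_add, map_add, hu, hv]
  | smul c u _ hu => rw [smul_mul_assoc, mul_smul_comm, map_smul, map_smul, hu]

/-- The partial isometries `S_{μj} S_{μi}^*` lie in the core, and so do their images under `α`.
Traciality then makes the `n` summands of `α (P_μ)` equal in mass. -/
lemma map_wordProjection (hS : IsCuntzAlgebra S) (α : A →⋆ₐ[ℂ] A)
    (hα : Set.MapsTo α (coreUHF S) (coreUHF S)) (μ : List (Fin n)) :
    φ (α (wordProjection S μ)) = ((n : ℂ)⁻¹) ^ μ.length := by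
  induction μ using List.reverseRecOn with
  | nil => simp [wordProjection, hφ.map_one]
  | append_singleton μ i ih =>
    have hcomm (j : Fin n) : φ (α (wordProjection S (μ ++ [j]))) =
        φ (α (wordProjection S (μ ++ [i]))) := by
      have hmem : wordIsometry S (μ ++ [j]) * star (wordIsometry S (μ ++ [i])) ∈ coreUHF S :=
        subset_closure (Set.mem_iUnion.2 ⟨_, monomial_mem_coreLevel (by simp)⟩)
      have h := hφ.map_mul_comm_of_mem_coreUHF (hα hmem)
        (α (wordIsometry S (μ ++ [i]) * star (wordIsometry S (μ ++ [j]))))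
      rw [← map_mul, ← map_mul] at h
      have key (ρ σ : List (Fin n)) : wordIsometry S ρ * star (wordIsometry S σ) *
          (wordIsometry S σ * star (wordIsometry S ρ)) = wordProjection S ρ := by
        rw [mul_assoc, ← mul_assoc (star _), hS.star_wordIsometry_mul_self, one_mul,
          wordProjection]
      rwa [key, key] at h
    have hsum : wordProjection S μ = ∑ j, wordProjection S (μ ++ [j]) := hS.monomial_eq_sum μ μ
    rw [hsum, map_sum, map_sum, Finset.sum_congr rfl fun j _ => hcomm j, Finset.sum_const,
      Finset.card_univ, Fintype.card_fin, nsmul_eq_mul] at ih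
    rw [List.length_append, List.length_singleton, pow_succ', ← ih,
      inv_mul_cancel_left₀ hS.natCast_ne_zero]

/-! ### The seminorm of a KMS state under right multiplication -/

lemma gnsNorm_one : gnsNorm φ 1 = 1 := by
  have h := gnsNorm_sq φ 1
  rw [star_one, one_mul, hφ.map_one] at h
  exact (pow_eq_one_iff_of_nonneg (gnsNorm_nonneg φ 1) two_ne_zero).1 (by exact_mod_cast h)

lemma gnsNorm_le_norm (x : A) : gnsNorm φ x ≤ ‖x‖ := by
  simpa [hφ.gnsNorm_one] using gnsNorm_mul_le φ x 1

/-- By the KMS identity the squares of the seminorms of the `x S_i` add up to `n` times that of `x`.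
The constant `√n` would do; `n` avoids the root. -/
lemma gnsNorm_mul_generator_le (hS : IsCuntzAlgebra S) (x : A) (j : Fin n) :
    gnsNorm φ (x * S j) ≤ n * gnsNorm φ x := by
  have hn : (1 : ℝ) ≤ n := by exact_mod_cast (by have := hS.two_le; omega : 1 ≤ n)
  have hsum : ∑ i, ((gnsNorm φ (x * S i) ^ 2 : ℝ) : ℂ) = ((n * gnsNorm φ x ^ 2 : ℝ) : ℂ) := by
    push_cast
    simp_rw [gnsNorm_sq]
    have h (i : Fin n) : φ (star (x * S i) * (x * S i)) =
        n * φ (star x * x * (S i * star (S i))) := by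
      rw [← mul_assoc (star x * x), hφ.map_mul_star, mul_inv_cancel_left₀ hS.natCast_ne_zero]
      simp only [star_mul, mul_assoc]
    simp_rw [h]
    rw [← Finset.mul_sum, ← map_sum, ← Finset.mul_sum, hS.sum_range, mul_one]
  have hsum' : ∑ i, gnsNorm φ (x * S i) ^ 2 = n * gnsNorm φ x ^ 2 := by exact_mod_cast hsum
  have hle := Finset.single_le_sum (f := fun i => gnsNorm φ (x * S i) ^ 2)
    (fun i _ => sq_nonneg _) (Finset.mem_univ j)
  rw [hsum'] at hle
  refine (sq_le_sq₀ (gnsNorm_nonneg _ _) (by have := gnsNorm_nonneg φ x; positivity)).1 ?_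
  refine hle.trans ?_
  rw [mul_pow]
  gcongr
  nlinarith

lemma gnsNorm_mul_star_generator_le (hS : IsCuntzAlgebra S) (x : A) (j : Fin n) :
    gnsNorm φ (x * star (S j)) ≤ gnsNorm φ x := by
  have hn : (1 : ℝ) ≤ n := by exact_mod_cast (by have := hS.two_le; omega : 1 ≤ n)
  have h : ((gnsNorm φ (x * star (S j)) ^ 2 : ℝ) : ℂ) =
      (((n : ℝ)⁻¹ * gnsNorm φ x ^ 2 : ℝ) : ℂ) := by
    push_cast
    rw [gnsNorm_sq, gnsNorm_sq, star_mul, star_star, mul_assoc, hφ.map_mul_left]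
    simp only [mul_assoc, hS.isometry, mul_one]
  have h' : gnsNorm φ (x * star (S j)) ^ 2 = (n : ℝ)⁻¹ * gnsNorm φ x ^ 2 := by exact_mod_cast h
  refine (sq_le_sq₀ (gnsNorm_nonneg _ _) (gnsNorm_nonneg _ _)).1 ?_
  rw [h']
  exact mul_le_of_le_one_left (sq_nonneg _) (inv_le_one_of_one_le₀ hn)

/-- The left kernel of a KMS state is a right ideal. -/
lemma gnsNorm_mul_eq_zero (hS : IsCuntzAlgebra S) {x : A} (hx : gnsNorm φ x = 0) (b : A) :
    gnsNorm φ (x * b) = 0 := by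
  have hword (μ : List (Fin n)) : ∀ x, gnsNorm φ x = 0 → gnsNorm φ (x * wordIsometry S μ) = 0 := by
    induction μ with
    | nil => simp
    | cons i μ ih =>
      intro x hx
      rw [wordIsometry_cons, ← mul_assoc]
      refine ih _ (le_antisymm ?_ (gnsNorm_nonneg _ _))
      simpa [hx] using hφ.gnsNorm_mul_generator_le hS x i
  have hstar (μ : List (Fin n)) :
      ∀ x, gnsNorm φ x = 0 → gnsNorm φ (x * star (wordIsometry S μ)) = 0 := by
    induction μ with
    | nil => simp
    | cons i μ ih =>
      intro x hx
      rw [wordIsometry_cons, star_mul, ← mul_assoc]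
      refine le_antisymm ?_ (gnsNorm_nonneg _ _)
      simpa [ih x hx] using hφ.gnsNorm_mul_star_generator_le hS (x * star (wordIsometry S μ)) i
  let N : Submodule ℂ A :=
    { carrier := {b | gnsNorm φ (x * b) = 0}
      zero_mem' := by simp [gnsNorm_zero]
      add_mem' := fun {a b} (ha : gnsNorm φ (x * a) = 0) (hb : gnsNorm φ (x * b) = 0) => by
        refine le_antisymm ?_ (gnsNorm_nonneg _ _)
        rw [mul_add]
        refine (gnsNorm_add_le φ _ _).trans_eq ?_
        rw [ha, hb, add_zero]
      smul_mem' := fun c a (ha : gnsNorm φ (x * a) = 0) => by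
        rw [Set.mem_ofPred_eq, mul_smul_comm, gnsNorm_smul, ha, mul_zero] }
  refine le_antisymm (le_of_forall_pos_le_add fun ε hε => ?_) (gnsNorm_nonneg _ _)
  obtain ⟨m, y, hy, hlt⟩ := hS.exists_degreeLE_norm_sub_lt b
    (show 0 < ε / (‖x‖ + 1) by positivity)
  have hyN : y ∈ N := by
    refine (iSup₂_le fun d _ => Submodule.span_le.2 ?_ : degreeLE S m ≤ N) hy
    rintro _ ⟨μ, ν, -, rfl⟩
    change gnsNorm φ _ = 0
    rw [← mul_assoc]
    exact hstar ν _ (hword μ x hx)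
  have hyN' : gnsNorm φ (x * y) = 0 := hyN
  rw [lt_div_iff₀ (by positivity)] at hlt
  calc gnsNorm φ (x * b) = gnsNorm φ (x * y + x * (b - y)) := by rw [← mul_add]; simp
    _ ≤ gnsNorm φ (x * y) + gnsNorm φ (x * (b - y)) := gnsNorm_add_le φ _ _
    _ ≤ 0 + ‖x * (b - y)‖ := by rw [hyN']; gcongr; exact hφ.gnsNorm_le_norm _
    _ ≤ 0 + ε := by
      gcongr
      refine (norm_mul_le _ _).trans ?_
      nlinarith [norm_nonneg x, norm_nonneg (b - y)]

/-- On each level of the core the norm is dominated by a multiple of the seminorm of `φ`. -/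
lemma exists_norm_le_gnsNorm (hS : IsCuntzAlgebra S) (k : ℕ) :
    ∃ C : ℝ, 0 ≤ C ∧ ∀ x ∈ coreLevel S k, ‖x‖ ≤ C * gnsNorm φ x := by
  induction k with
  | zero =>
    refine ⟨1, zero_le_one, fun x hx => ?_⟩
    obtain ⟨c, rfl⟩ := IsCuntzAlgebra.mem_coreLevel_zero hx
    have := hS.nontrivial
    rw [gnsNorm_smul, hφ.gnsNorm_one, norm_smul, CStarRing.norm_one, one_mul]
  | succ k ih =>
    obtain ⟨C, hC, h⟩ := ih
    -- There are `n²` matrix blocks; each costs `C` from the level below and `n` from right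
    -- multiplication by `S j`.
    refine ⟨n * (n * (C * n)), by positivity, fun x hx => ?_⟩
    have hterm (i j : Fin n) :
        ‖S i * (star (S i) * x * S j) * star (S j)‖ ≤ C * n * gnsNorm φ x := by
      have hi := IsCuntzAlgebra.norm_le_one_of_isometry (hS.isometry i)
      have hj := IsCuntzAlgebra.norm_le_one_of_isometry (hS.isometry j)
      calc ‖S i * (star (S i) * x * S j) * star (S j)‖
          ≤ ‖S i‖ * ‖star (S i) * x * S j‖ * ‖S j‖ := by
            refine (norm_mul_le _ _).trans ?_
            rw [norm_star]
            gcongr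
            exact norm_mul_le _ _
        _ ≤ 1 * ‖star (S i) * x * S j‖ * 1 := by gcongr
        _ ≤ C * gnsNorm φ (star (S i) * (x * S j)) := by
            rw [one_mul, mul_one, ← mul_assoc]
            exact h _ (hS.star_mul_mul_mem_coreLevel hx i j)
        _ ≤ C * (‖star (S i)‖ * gnsNorm φ (x * S j)) := by
            gcongr
            exact gnsNorm_mul_le φ _ _
        _ ≤ C * (1 * (n * gnsNorm φ x)) := by
            rw [norm_star]
            gcongr
            · exact gnsNorm_nonneg φ _
            · exact hφ.gnsNorm_mul_generator_le hS x j
        _ = C * n * gnsNorm φ x := by ring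
    calc ‖x‖ = ‖∑ i, ∑ j, S i * (star (S i) * x * S j) * star (S j)‖ := by
          rw [← hS.eq_sum_compress x]
      _ ≤ ∑ _i : Fin n, ∑ _j : Fin n, C * n * gnsNorm φ x :=
          norm_sum_le_of_le _ fun i _ => norm_sum_le_of_le _ fun j _ => hterm i j
      _ = _ := by simp; ring

/-! ### Faithfulness of KMS states -/

-- If `a > M`, the powers of `a / M` outgrow any linear function of the exponent.
omit hφ [PartialOrder A] [StarOrderedRing A] [CStarAlgebra A] in
lemma le_of_pow_two_pow_le {a M C D : ℝ} (hM : 0 < M)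
    (h : ∀ i : ℕ, a ^ (2 ^ i) ≤ (C * (2 ^ i : ℕ) + D) * M ^ (2 ^ i)) : a ≤ M := by
  by_contra! hlt
  have hr : 1 < a / M := (one_lt_div hM).2 hlt
  have h1 := tendsto_pow_const_div_const_pow_of_one_lt 1 hr
  have h0 := tendsto_pow_const_div_const_pow_of_one_lt 0 hr
  have h2 := ((h1.const_mul C).add (h0.const_mul D)).comp
    (tendsto_pow_atTop_atTop_of_one_lt (one_lt_two (α := ℕ)))
  have h3 : (1 : ℝ) ≤ C * 0 + D * 0 := by
    refine ge_of_tendsto h2 (Eventually.of_forall fun i => ?_)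
    have hpos : 0 < (a / M) ^ (2 ^ i) := by positivity
    simp only [Function.comp_apply, pow_one, pow_zero, mul_one_div]
    rw [← mul_div_assoc, ← add_div, one_le_div hpos, div_pow, div_le_iff₀ (by positivity)]
    exact h i
  norm_num at h3

/-- Homogeneous components are bounded by the operator norm in the GNS representation. -/
lemma norm_component_le (hS : IsCuntzAlgebra S) {s : Finset ℤ} {f : ℤ → A}
    (hf : ∀ d, f d ∈ gradedPart S d) {M : ℝ} (hM : 0 < M)
    (hw : ∀ b, gnsNorm φ ((∑ d ∈ s, f d) * b) ≤ M * gnsNorm φ b) {d : ℤ} (hd : d ∈ s) :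
    ‖f d‖ ≤ M := by
  -- For `b` of degree zero, the `f e * b` have distinct degrees and are `φ`-orthogonal, so `f d *
  -- b` is an orthogonal component of the full product.
  have hcomp {b : A} (hb : b ∈ gradedPart S 0) : gnsNorm φ (f d * b) ≤ M * gnsNorm φ b := by
    refine le_trans ?_ (hw b)
    have h : φ (star (f d * b) * (f d * b)) = φ (star (f d * b) * ((∑ e ∈ s, f e) * b)) := by
      rw [Finset.sum_mul, Finset.mul_sum, map_sum, Finset.sum_eq_single_of_mem d hd]
      intro e _ he
      refine hφ.map_eq_zero_of_mem_gradedPart hS (d := -(d + 0) + (e + 0)) (by omega) ?_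
      exact hS.mul_mem_gradedPart (star_mem_gradedPart (hS.mul_mem_gradedPart (hf d) hb))
        (hS.mul_mem_gradedPart (hf e) hb)
    have h2 := norm_map_star_mul_le φ (f d * b) ((∑ e ∈ s, f e) * b)
    rw [← h, ← gnsNorm_sq, norm_pow, Complex.norm_real, Real.norm_of_nonneg (gnsNorm_nonneg φ _),
      sq] at h2
    rcases (gnsNorm_nonneg φ (f d * b)).eq_or_lt with h0 | h0
    · rw [← h0]
      exact gnsNorm_nonneg φ _
    · exact le_of_mul_le_mul_left h2 h0
  set v := star (f d) * f d with hv
  have hv0 : v ∈ gradedPart S 0 := by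
    simpa using hS.mul_mem_gradedPart (star_mem_gradedPart (hf d)) (hf d)
  have hpow0 (i : ℕ) : v ^ i ∈ gradedPart S 0 := by
    induction i with
    | zero => exact pow_zero v ▸ one_mem_gradedPart
    | succ i ih => simpa [pow_succ] using hS.mul_mem_gradedPart ih hv0
  have hvsa : IsSelfAdjoint v := IsSelfAdjoint.star_mul_self _
  -- Cauchy–Schwarz after splitting one factor `v = (f d)^* (f d)`; both resulting vectors are `f d`
  -- times a power of `v`, so `hcomp` applies twice.
  have hstep (i : ℕ) : gnsNorm φ (v ^ (i + 1)) ≤ M ^ 2 * gnsNorm φ (v ^ i) := by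
    have h : star (v ^ (i + 1)) * v ^ (i + 1) = star (f d * v ^ (i + 1)) * (f d * v ^ i) := by
      rw [star_mul, pow_succ' v i]
      simp only [hv, mul_assoc]
    have h2 := norm_map_star_mul_le φ (f d * v ^ (i + 1)) (f d * v ^ i)
    rw [← h, ← gnsNorm_sq, norm_pow, Complex.norm_real,
      Real.norm_of_nonneg (gnsNorm_nonneg φ _), sq] at h2
    have h3 : gnsNorm φ (v ^ (i + 1)) * gnsNorm φ (v ^ (i + 1)) ≤
        gnsNorm φ (v ^ (i + 1)) * (M ^ 2 * gnsNorm φ (v ^ i)) := by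
      refine h2.trans ((mul_le_mul (hcomp (hpow0 (i + 1))) (hcomp (hpow0 i))
        (gnsNorm_nonneg φ _) (mul_nonneg hM.le (gnsNorm_nonneg φ _))).trans_eq ?_)
      ring
    rcases (gnsNorm_nonneg φ (v ^ (i + 1))).eq_or_lt with h0 | h0
    · rw [← h0]
      exact mul_nonneg (sq_nonneg _) (gnsNorm_nonneg φ _)
    · exact le_of_mul_le_mul_left h3 h0
  have hpow (i : ℕ) : gnsNorm φ (v ^ i) ≤ (M ^ 2) ^ i := by
    induction i with
    | zero => rw [pow_zero, pow_zero, hφ.gnsNorm_one]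
    | succ i ih =>
      rw [pow_succ' (M ^ 2)]
      exact (hstep i).trans (by gcongr)
  obtain ⟨k, hk⟩ := hS.exists_mem_coreLevel hv0
  obtain ⟨C, hC, hbound⟩ := hφ.exists_norm_le_gnsNorm hS k
  -- All powers of `v` stay in one level of the core, so a single constant `C` serves for them all
  -- and disappears on taking roots.
  have hvM : ‖v‖ ≤ M ^ 2 := by
    refine le_of_pow_two_pow_le (C := 0) (D := C) (by positivity) fun i => ?_
    rw [← hvsa.norm_pow_two_pow, zero_mul, zero_add]
    exact (hbound _ (hS.pow_mem_coreLevel hk _)).trans (by gcongr; exact hpow _)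
  rw [hv, CStarRing.norm_star_mul_self, ← sq] at hvM
  exact (sq_le_sq₀ (norm_nonneg _) hM.le).1 hvM

/-- A KMS state on a Cuntz algebra is faithful. -/
theorem eq_zero_of_gnsNorm_eq_zero (hS : IsCuntzAlgebra S) {x : A} (hx : IsSelfAdjoint x)
    (h0 : gnsNorm φ x = 0) : x = 0 := by
  refine norm_le_zero_iff.1 (le_of_forall_pos_le_add fun δ hδ => ?_)
  set ε := δ / 2 with hε_def
  have hε : 0 < ε := by positivity
  obtain ⟨m, z, hz, hxz⟩ := hS.exists_degreeLE_norm_sub_lt x hε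
  -- Symmetrising `z` keeps the approximation and gives `‖y ^ (2 ^ i)‖ = ‖y‖ ^ (2 ^ i)`.
  obtain ⟨y, hy, hysa, hxy⟩ : ∃ y ∈ degreeLE S m, IsSelfAdjoint y ∧ ‖x - y‖ ≤ ε := by
    refine ⟨(2⁻¹ : ℂ) • (z + star z), Submodule.smul_mem _ _ (add_mem hz (star_mem_degreeLE hz)),
      ?_, ?_⟩
    · rw [IsSelfAdjoint, star_smul, star_add, star_star, add_comm]
      simp
    · have : x - (2⁻¹ : ℂ) • (z + star z) = (2⁻¹ : ℂ) • ((x - z) + star (x - z)) := by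
        rw [star_sub, hx.star_eq]
        module
      rw [this, norm_smul]
      have := norm_add_le (x - z) (star (x - z))
      rw [norm_star] at this
      rw [norm_inv, Complex.norm_two]
      linarith
  -- The left kernel is also a right ideal, so `x * b` has seminorm zero and only `y - x`
  -- contributes.
  have hyb (b : A) : gnsNorm φ (y * b) ≤ ε * gnsNorm φ b := by
    calc gnsNorm φ (y * b) = gnsNorm φ (x * b + (y - x) * b) := by rw [← add_mul]; simp
      _ ≤ gnsNorm φ (x * b) + gnsNorm φ ((y - x) * b) := gnsNorm_add_le φ _ _
      _ ≤ 0 + ‖y - x‖ * gnsNorm φ b := by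
        rw [hφ.gnsNorm_mul_eq_zero hS h0]
        gcongr
        exact gnsNorm_mul_le φ _ _
      _ ≤ ε * gnsNorm φ b := by
        rw [zero_add, norm_sub_rev]
        gcongr
        exact gnsNorm_nonneg φ b
  have hpow (j : ℕ) (b : A) : gnsNorm φ (y ^ j * b) ≤ ε ^ j * gnsNorm φ b := by
    induction j with
    | zero => simp
    | succ j ih =>
      rw [pow_succ', mul_assoc, pow_succ', mul_assoc]
      exact (hyb _).trans (by gcongr)
  have hyε : ‖y‖ ≤ ε := by
    -- `y ^ (2 ^ i)` has degrees between `-2 ^ i * m` and `2 ^ i * m`, hence `2 * m * 2 ^ i + 1`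
    -- components, each of norm at most `ε ^ (2 ^ i)`.
    refine le_of_pow_two_pow_le (C := 2 * m) (D := 1) hε fun i => ?_
    rw [← hysa.norm_pow_two_pow]
    obtain ⟨f, hf, hsum⟩ := mem_degreeLE_iff.1 (hS.pow_mem_degreeLE hy (2 ^ i))
    rw [← hsum]
    refine (norm_sum_le_of_le _ fun d hd => hφ.norm_component_le hS hf (pow_pos hε (2 ^ i))
      (fun b => by rw [hsum]; exact hpow _ b) hd).trans_eq ?_
    rw [Finset.sum_const, nsmul_eq_mul, Int.card_Icc]
    congr 1
    have : (((2 ^ i * m : ℕ) : ℤ) + 1 - -((2 ^ i * m : ℕ) : ℤ)).toNat = 2 * (2 ^ i * m) + 1 := by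
      omega
    rw [this]
    push_cast
    ring
  calc ‖x‖ = ‖(x - y) + y‖ := by simp
    _ ≤ ‖x - y‖ + ‖y‖ := norm_add_le _ _
    _ ≤ 0 + δ := by linarith

end IsKMSState

/-- An endomorphism preserving the core is modestly scaling. -/
theorem IsCuntzAlgebra.isModestlyScaling_of_mapsTo (hS : IsCuntzAlgebra S) (α : A →⋆ₐ[ℂ] A)
    (hα : Set.MapsTo α (coreUHF S) (coreUHF S)) : IsModestlyScaling S α := by
  intro ν hν p hp hle
  obtain ⟨φ, h1, hkms⟩ := hS.exists_kmsState
  have hφ : IsKMSState S φ := ⟨h1, hkms⟩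
  refine hφ.eq_zero_of_gnsNorm_eq_zero hS hp.isSelfAdjoint ?_
  -- For a projection the squared seminorm is `φ p` itself.
  have hsq := gnsNorm_sq φ p
  rw [hp.isSelfAdjoint.star_eq, hp.isIdempotentElem.eq] at hsq
  have hn1 : (n : ℝ)⁻¹ < 1 := inv_lt_one_of_one_lt₀ (by exact_mod_cast hS.two_le)
  have hbound (k : ℕ) : gnsNorm φ p ^ 2 ≤ ((n : ℝ)⁻¹) ^ k := by
    set w := ((List.range (k + 1)).map ν).flatten with hw
    have hlen : k ≤ w.length := by
      rw [hw, List.length_flatten, List.map_map]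
      have := List.card_nsmul_le_sum ((List.range (k + 1)).map (List.length ∘ ν)) 1 (by
        intro x hx
        obtain ⟨i, -, rfl⟩ := List.mem_map.1 hx
        exact List.length_pos_iff.2 (hν i))
      simp at this ⊢
      omega
    have h := OrderHomClass.mono φ (hle k)
    rw [hφ.map_wordProjection hS α hα, ← hsq, ← hw] at h
    have h' : gnsNorm φ p ^ 2 ≤ ((n : ℝ)⁻¹) ^ w.length := by
      rw [← Complex.real_le_real]
      push_cast
      exact h
    exact h'.trans (pow_le_pow_of_le_one (by positivity) hn1.le hlen)
  have h0 : gnsNorm φ p ^ 2 ≤ 0 :=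
    ge_of_tendsto' (tendsto_pow_atTop_nhds_zero_of_lt_one (by positivity) hn1) hbound
  exact pow_eq_zero_iff two_ne_zero |>.1 (le_antisymm h0 (sq_nonneg _))

end Cuntz

theorem proposition3p2 {n : ℕ} {A : Type*} [CStarAlgebra A] [PartialOrder A] [StarOrderedRing A]
    (S : Fin n → A) (hS : Cuntz.IsCuntzAlgebra S) (α : A →⋆ₐ[ℂ] A)
    (hα : (∃ e : A ≃⋆ₐ[ℂ] A, ∀ x, e x = α x) ∨
      Set.MapsTo α (Cuntz.coreUHF S) (Cuntz.coreUHF S)) :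
    Cuntz.IsModestlyScaling S α := by
  rcases hα with ⟨e, he⟩ | hα
  · intro ν hν p hp hle
    -- The inverse automorphism carries `p` to a projection below the `P_μ` themselves, so the
    -- identity endomorphism suffices.
    have hid := hS.isModestlyScaling_of_mapsTo (StarAlgHom.id ℂ A) (Set.mapsTo_id _)
    have h0 := hid ν hν (e.symm p) (hp.map e.symm) fun k => by
      have h := OrderHomClass.mono e.symm (hle k)
      rwa [← he, e.symm_apply_apply] at h
    simpa using congrArg e h0
  · exact hS.isModestlyScaling_of_mapsTo α hα
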